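/- Let $G=(V,E,u)$ be an undirected graph (finitely many edges, no loops) with capacities $u(e)>0$, arbitrarily oriented, with incidence matrix $B$ ($B(e,v)=1$ if $v$ is the head of $e$, $-1$ if $v$ is its tail, $0$ otherwise). Let $k\ge 1$ be the number of commodities and $d_1,\dots,d_k\in\mathbb R^V$ the demands, and let $0<\epsilon\le 1$. A $k$-commodity flow assigns to each edge $e$ a vector $f(e)\in\mathbb R^k$; it meets the demands if $B^{T}f_i=d_i$ for every commodity $i$. *Oracle.* The algorithm has access to a procedure for quadratically capacitated flow. Given symmetric positive definite $k\times k$ matrices $P(e)$, $e\in E$, each of condition number at most $2k/\epsilon$, it returns either a flow $f$ that meets the demands with $f(e)^{T}P(e)f(e)\le 1+2\epsilon$ for every $e$, or FAIL; it returns FAIL only if no flow $f$ that meets the demands satisfies $f(e)^{T}P(e)f(e)\le 1+\epsilon$ for every $e$. Its answers may depend on the history of queries. *Algorithm* MaxConcurrentFlow with $N$ iterations. Put $\rho=\sqrt{k/\epsilon}$, $\epsilon_1=\epsilon^{1/2}/k^{3/2}$, $\epsilon_1'=-\ln(1-\epsilon_1)$ (any value, say $0$, in the trivial case $k=\epsilon=1$),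 and start with $S^{(0)}(e)=0$, $W^{(0)}(e)=I$ for each edge $e$. In iteration $t=1,\dots,N$: 1. query the oracle with $P^{(t-1)}(e)=\frac1{u(e)^2}\Big(\frac{W^{(t-1)}(e)}{\|W^{(t-1)}(e)\|_\infty}+\epsilon I\Big)$, where $\|W\|_\infty=\max_{i,j}|W_{ij}|$; if it returns FAIL, stop and return FAIL, and otherwise let $f^{(t)}$ be the flow returned; 2. for each edge $e$ let $i$ be an index of a largest diagonal entry of $W^{(t-1)}(e)$ (ties broken arbitrarily), let $\mathbf 1_i$ be the matrix whose only nonzero entry is a $1$ at $(i,i)$, and set $$M^{(t)}(e)=\frac1{2\rho}\Big((1+2\epsilon)\mathbf 1_{i}-\frac1{u(e)^2}f^{(t)}(e)f^{(t)}(e)^{T}+\rho I\Big),$$ $$S^{(t)}(e)=S^{(t-1)}(e)+M^{(t)}(e),\qquad W^{(t)}(e)=\exp\big(-\epsilon_1' S^{(t)}(e)\big).$$ After iteration $N$ return $\bar f=\frac1N\sum_{t=1}^N f^{(t)}$. **Theorem.** Let $N\ge 1$ be any integer with $N\ge k^{7/2}\epsilon^{-5/2}\ln k$ (so $O(k^{7/2}\epsilon^{-5/2}\log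 k)$ iterations suffice when $k\ge2$). If MaxConcurrentFlow with $N$ iterations returns a flow $\bar f$, then $\bar f$ meets the demands and $$\|\bar f(e)\|_1=\sum_{i=1}^k|\bar f_i(e)|\le(1+3\epsilon)\,u(e)\qquad\text{for every edge }e.$$ Moreover, if some flow $f$ meets the demands and satisfies $\|f(e)\|_1\le u(e)$ for every edge $e$, then the algorithm does not return FAIL. -/

import Mathlib

namespace MultiFlow

open Matrix

/-- An undirected capacitated graph with vertex set `V` and edge set `E` (parallel edges allowed,
no loops), together with an arbitrary orientation of the edges. -/
structure CapGraph (V E : Type*) where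
  head : E → V
  tail : E → V
  head_ne_tail : ∀ e, head e ≠ tail e
  cap : E → ℝ
  cap_pos : ∀ e, 0 < cap e

/-- A `k`-commodity flow: the row `f e` is the vector of the `k` flow values on the edge `e`. -/
abbrev Flow (E : Type*) (k : ℕ) := Matrix E (Fin k) ℝ

/-- One `k × k` matrix per edge (the diagonal blocks of a `km × km` block-diagonal matrix). -/
abbrev EdgeMatrices (E : Type*) (k : ℕ) := E → Matrix (Fin k) (Fin k) ℝ

/-- The edge-vertex incidence matrix. -/
def CapGraph.incidence {V E : Type*} [DecidableEq V] (G : CapGraph V E) : Matrix E V ℝ :=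
  Matrix.of fun e v => if v = G.head e then 1 else if v = G.tail e then -1 else 0

/-- The flow `f` meets the demands `d`: `Bᵀ fᵢ = dᵢ` for each commodity `i`. -/
def CapGraph.MeetsDemands {V E : Type*} [DecidableEq V] [Fintype E] {k : ℕ}
    (G : CapGraph V E) (d : Matrix V (Fin k) ℝ) (f : Flow E k) : Prop :=
  G.incidenceᵀ * f = d

/-- The total flow `‖f(e)‖₁` of all commodities on the edge `e`. -/
def l1OnEdge {E : Type*} {k : ℕ} (f : Flow E k) (e : E) : ℝ := ∑ i, |f e i|

/-- The energy `f(e)ᵀ P(e) f(e)` of the flow `f` on the edge `e`, which is the square of its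
saturation with respect to `P`. -/
def edgeEnergy {E : Type*} {k : ℕ} (P : EdgeMatrices E k) (f : Flow E k) (e : E) : ℝ :=
  f e ⬝ᵥ (P e *ᵥ f e)

/-- Every `P(e)` is symmetric positive definite with condition number at most `κ`:
`a I ≼ P(e) ≼ κ a I` for some `a > 0`. -/
def WellConditioned {E : Type*} {k : ℕ} (κ : ℝ) (P : EdgeMatrices E k) : Prop :=
  ∀ e, ∃ a : ℝ, 0 < a ∧ (P e - a • (1 : Matrix (Fin k) (Fin k) ℝ)).PosSemidef ∧
    ((κ * a) • (1 : Matrix (Fin k) (Fin k) ℝ) - P e).PosSemidef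

/-- The input-output contract of a procedure for quadratically capacitated flow. On energy matrices
of condition number at most `κ` it returns either a flow that meets the demands and whose energy on
each edge is at most `hi`, or FAIL (`none`), and it may fail only if no flow meets the demands with
energy at most `lo` on each edge. The first argument is the number of the query, so that answers
may depend on the history. -/
def IsQuadCapFlowOracle {V E : Type*} [DecidableEq V] [Fintype E] {k : ℕ}
    (G : CapGraph V E) (d : Matrix V (Fin k) ℝ) (κ lo hi : ℝ)
    (oracle : ℕ → EdgeMatrices E k → Option (Flow E k)) : Prop :=
  ∀ (t : ℕ) (P : EdgeMatrices E k), WellConditioned κ P →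
    (∀ f, oracle t P = some f → G.MeetsDemands d f ∧ ∀ e, edgeEnergy P f e ≤ hi) ∧
    (oracle t P = none → ¬ ∃ f, G.MeetsDemands d f ∧ ∀ e, edgeEnergy P f e ≤ lo)

/-- `sel` picks an index of a largest diagonal entry, with an arbitrary rule for ties. -/
def IsDiagArgmax {k : ℕ} (sel : Matrix (Fin k) (Fin k) ℝ → Fin k) : Prop :=
  ∀ (W : Matrix (Fin k) (Fin k) ℝ) (i : Fin k), W i i ≤ W (sel W) (sel W)

/-- The largest absolute value of an entry. -/
noncomputable def maxEntry {k : ℕ} (W : Matrix (Fin k) (Fin k) ℝ) : ℝ := ⨆ i, ⨆ j, |W i j|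

/-- The width parameter `ρ = (k / ε)^{1/2}`. -/
noncomputable def width (k : ℕ) (ε : ℝ) : ℝ := Real.sqrt (k / ε)

/-- The parameter `ε₁ = ε^{1/2} / k^{3/2}`. -/
noncomputable def eps1 (k : ℕ) (ε : ℝ) : ℝ := ε ^ (1 / 2 : ℝ) / (k : ℝ) ^ (3 / 2 : ℝ)

/-- The parameter `ε₁' = - ln (1 - ε₁)`. -/
noncomputable def eps1' (k : ℕ) (ε : ℝ) : ℝ := -Real.log (1 - eps1 k ε)

/-- The energy matrix `P(e) = u⁻² (W / ‖W‖_∞ + ε I)` of an edge of capacity `u`. -/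
noncomputable def energyMatrix {k : ℕ} (ε u : ℝ) (W : Matrix (Fin k) (Fin k) ℝ) :
    Matrix (Fin k) (Fin k) ℝ :=
  (1 / u ^ 2) • ((1 / maxEntry W) • W + ε • (1 : Matrix (Fin k) (Fin k) ℝ))

/-- The matrix `M = (1 / 2ρ) ((1 + 2ε) 1_i - u⁻² f fᵀ + ρ I)` of an edge of capacity `u`, where
`f` is the flow vector of the edge and `1_i` has its only nonzero entry, a `1`, at `(i, i)`. -/
noncomputable def lossMatrix {k : ℕ} (ε u : ℝ) (i : Fin k) (f : Fin k → ℝ) :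
    Matrix (Fin k) (Fin k) ℝ :=
  (1 / (2 * width k ε)) •
    ((1 + 2 * ε) • Matrix.single i i (1 : ℝ) - (1 / u ^ 2) • Matrix.vecMulVec f f
      + width k ε • (1 : Matrix (Fin k) (Fin k) ℝ))

/-- The update of an edge of capacity `u`: from `(S, W)` and the new flow vector `f` of the edge,
the new sum `S + M` and its matrix exponential `exp (-ε₁' (S + M))`. -/
noncomputable def update {k : ℕ} (sel : Matrix (Fin k) (Fin k) ℝ → Fin k) (ε u : ℝ)
    (SW : Matrix (Fin k) (Fin k) ℝ × Matrix (Fin k) (Fin k) ℝ) (f : Fin k → ℝ) :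
    Matrix (Fin k) (Fin k) ℝ × Matrix (Fin k) (Fin k) ℝ :=
  (SW.1 + lossMatrix ε u (sel SW.2) f,
    NormedSpace.exp (-(eps1' k ε) • (SW.1 + lossMatrix ε u (sel SW.2) f)))

/-- The state of the outer loop: the pair `(S(e), W(e))` of each edge, and the sum of the flows
returned by the oracle so far. -/
structure OuterState (E : Type*) (k : ℕ) where
  SW : E → Matrix (Fin k) (Fin k) ℝ × Matrix (Fin k) (Fin k) ℝ
  total : Flow E k

/-- The state after `t` iterations; `none` if the oracle has failed. -/
noncomputable def outerRun {V E : Type*} {k : ℕ} (G : CapGraph V E)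
    (oracle : ℕ → EdgeMatrices E k → Option (Flow E k))
    (sel : Matrix (Fin k) (Fin k) ℝ → Fin k) (ε : ℝ) : ℕ → Option (OuterState E k)
  | 0 => some ⟨fun _ => (0, 1), 0⟩
  | t + 1 => (outerRun G oracle sel ε t).bind fun st =>
      (oracle t fun e => energyMatrix ε (G.cap e) (st.SW e).2).map fun f =>
        ⟨fun e => update sel ε (G.cap e) (st.SW e) (f e), st.total + f⟩

/-- The algorithm for maximum concurrent flow with `N` iterations: the average of the `N` flows
returned by the oracle, or `none` if the oracle fails in one of the iterations. -/
noncomputable def maxConcurrentFlow {V E : Type*} {k : ℕ} (G : CapGraph V E)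
    (oracle : ℕ → EdgeMatrices E k → Option (Flow E k))
    (sel : Matrix (Fin k) (Fin k) ℝ → Fin k) (ε : ℝ) (N : ℕ) : Option (Flow E k) :=
  (outerRun G oracle sel ε N).map fun st => (1 / (N : ℝ)) • st.total

end MultiFlow

open Matrix

/-! ### Trace inequalities for powers of products of symmetric matrices. -/

namespace Matrix

variable {n : Type*} [Fintype n]

/-! The argument is matrix multiplicative weights, run on each edge with potential `tr W`. Write `g
= f/u`, `a = 1 + 2ε`, `η = ε₁'/(2ρ)`. Since `W` is positive semidefinite, `‖W‖_∞` is its largest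
diagonal entry `W i i`, so the oracle guarantees `gᵀWg + ε W i i |g|² ≤ a W i i`. Up to the scalar
factor `exp(-ε₁'/2)`, one round changes the exponent by `-η(a 1ᵢ - ggᵀ)`. By Golden–Thompson
(`Matrix.trace_exp_add_le`) and `e^y ≤ 1 + y + y²`, the potential then grows by at most `1 + 2η²a²`
(`trace_mul_exp_rankOne_update_le`); the `ε|g|²` term pays for the second-order effect of `ggᵀ`.

Since `log tr W` bounds the top eigenvalue of `-ε₁'S`, testing with a sign vector `s` gives `∑ₜ
(s·gₜ)² ≤ aN + k ln k/η + 2kηa²N`, which is at most `N(1+3ε)²` (`averaged_energy_bound`). Taking `s`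
to be the signs of the total flow and applying Cauchy–Schwarz in tangent-line form gives the `ℓ₁`
bound.

For FAIL: `fᵀWf ≤ ‖W‖_∞ ‖f‖₁²`, so a feasible flow has energy at most `1 + ε` for every query. -/

theorem trace_mul_self_transpose_nonneg (X : Matrix n n ℝ) : 0 ≤ (X * Xᵀ).trace := by
  simpa using (posSemidef_self_mul_conjTranspose X).trace_nonneg

theorem sq_trace_mul_le (X Y : Matrix n n ℝ) :
    (X * Y).trace ^ 2 ≤ (X * Xᵀ).trace * (Y * Yᵀ).trace := by
  have h1 : ∀ A B : Matrix n n ℝ, (A * B).trace = ∑ p : n × n, A p.1 p.2 * B p.2 p.1 := by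
    intro A B
    simp [trace, mul_apply, Fintype.sum_prod_type]
  have h2 : ∀ A : Matrix n n ℝ, ∑ p : n × n, A p.2 p.1 ^ 2 = ∑ p : n × n, A p.1 p.2 ^ 2 := by
    intro A
    rw [Fintype.sum_prod_type, Fintype.sum_prod_type, Finset.sum_comm]
  rw [h1, h1, h1]
  simp only [transpose_apply, ← pow_two]
  rw [← h2 Y]
  exact Finset.sum_mul_sq_le_sq_mul_sq _ _ _

theorem trace_mul_le_of_trace_eq {X Y : Matrix n n ℝ} (h : (Y * Yᵀ).trace = (X * Xᵀ).trace) :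
    (X * Y).trace ≤ (X * Xᵀ).trace := by
  have h1 := sq_trace_mul_le X Y
  rw [h, ← pow_two] at h1
  exact (abs_le_of_sq_le_sq' h1 (trace_mul_self_transpose_nonneg X)).2

theorem trace_mul_self_le (X : Matrix n n ℝ) : (X * X).trace ≤ (X * Xᵀ).trace :=
  trace_mul_le_of_trace_eq rfl

variable [DecidableEq n]

theorem trace_mul_pow_comm (A B : Matrix n n ℝ) (m : ℕ) :
    ((A * B) ^ m).trace = ((B * A) ^ m).trace := by
  cases m with
  | zero => simp
  | succ m =>
    have h : SemiconjBy A (B * A) (A * B) := mul_assoc A B A |>.symm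
    rw [pow_succ, ← mul_assoc, ← (h.pow_right m).eq, trace_mul_comm, ← mul_assoc, ← pow_succ']

/-- Araki–Lieb–Thirring type inequalities for exponents that are powers of two. -/
theorem trace_pow_two_pow_aux (j : ℕ) :
    (∀ X : Matrix n n ℝ,
      (X ^ 2 ^ j * (X ^ 2 ^ j)ᵀ).trace ≤ ((X * Xᵀ) ^ 2 ^ j).trace) ∧
    (∀ P Q : Matrix n n ℝ, Pᵀ = P → Qᵀ = Q →
      ((P * Q) ^ 2 ^ j).trace ≤ (P ^ 2 ^ j * Q ^ 2 ^ j).trace) := by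
  induction j with
  | zero => simp
  | succ j ih =>
    obtain ⟨ihS, ihT⟩ := ih
    have key : ∀ (A : Matrix n n ℝ), A ^ 2 ^ (j + 1) = (A ^ 2) ^ 2 ^ j := by
      intro A; rw [← pow_mul, pow_succ']
    constructor
    -- `XᵀX` and `XXᵀ` have powers of equal Frobenius norm, so Cauchy–Schwarz closes the chain once
    -- the second inequality at level `j` has separated the factors.
    · intro X
      have hP : (Xᵀ * X)ᵀ = Xᵀ * X := by simp
      have hQ : (X * Xᵀ)ᵀ = X * Xᵀ := by simp
      have htr : ((Xᵀ * X) ^ 2 ^ j * ((Xᵀ * X) ^ 2 ^ j)ᵀ).trace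
          = ((X * Xᵀ) ^ 2 ^ j * ((X * Xᵀ) ^ 2 ^ j)ᵀ).trace := by
        rw [transpose_pow, transpose_pow, hP, hQ, ← pow_add, ← pow_add, trace_mul_pow_comm]
      calc (X ^ 2 ^ (j + 1) * (X ^ 2 ^ (j + 1))ᵀ).trace
          ≤ ((X ^ 2 * (X ^ 2)ᵀ) ^ 2 ^ j).trace := by rw [key]; exact ihS _
        _ = ((Xᵀ * X * (X * Xᵀ)) ^ 2 ^ j).trace := by
          rw [show X ^ 2 * (X ^ 2)ᵀ = X * (X * Xᵀ * Xᵀ) by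
            simp [pow_two, mul_assoc], trace_mul_pow_comm,
            show X * Xᵀ * Xᵀ * X = X * Xᵀ * (Xᵀ * X) by simp [mul_assoc], trace_mul_pow_comm]
        _ ≤ ((Xᵀ * X) ^ 2 ^ j * (X * Xᵀ) ^ 2 ^ j).trace := ihT _ _ hP hQ
        _ ≤ ((X * Xᵀ) ^ 2 ^ j * ((X * Xᵀ) ^ 2 ^ j)ᵀ).trace := by
          rw [← htr]; exact trace_mul_le_of_trace_eq htr.symm
        _ = ((X * Xᵀ) ^ 2 ^ (j + 1)).trace := by
          rw [transpose_pow, hQ, ← pow_add, pow_succ, mul_two]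
    -- Squaring `Y = (PQ)^(2^j)` costs `tr Y² ≤ tr YYᵀ`; cyclicity then turns `PQ(PQ)ᵀ` into `P²Q²`.
    · intro P Q hP hQ
      calc ((P * Q) ^ 2 ^ (j + 1)).trace
          = ((P * Q) ^ 2 ^ j * (P * Q) ^ 2 ^ j).trace := by rw [pow_succ, mul_two, pow_add]
        _ ≤ ((P * Q) ^ 2 ^ j * ((P * Q) ^ 2 ^ j)ᵀ).trace := trace_mul_self_le _
        _ ≤ ((P * Q * (P * Q)ᵀ) ^ 2 ^ j).trace := ihS _
        _ = ((P ^ 2 * Q ^ 2) ^ 2 ^ j).trace := by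
          rw [transpose_mul, hP, hQ, show P * Q * (Q * P) = P * (Q ^ 2 * P) by
            simp [pow_two, mul_assoc], trace_mul_pow_comm,
            show Q ^ 2 * P * P = Q ^ 2 * P ^ 2 by simp [pow_two, mul_assoc], trace_mul_pow_comm]
        _ ≤ ((P ^ 2) ^ 2 ^ j * (Q ^ 2) ^ 2 ^ j).trace :=
          ihT _ _ (by rw [transpose_pow, hP]) (by rw [transpose_pow, hQ])
        _ = (P ^ 2 ^ (j + 1) * Q ^ 2 ^ (j + 1)).trace := by rw [key, key]

end Matrix

/-! ### The Lie–Trotter formula and the Golden–Thompson inequality. -/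

section LieTrotter

open NormedSpace Filter Topology

theorem norm_pow_sub_pow_le {𝔸 : Type*} [NormedRing 𝔸] [NormOneClass 𝔸] {x y : 𝔸} {c : ℝ}
    (hx : ‖x‖ ≤ c) (hy : ‖y‖ ≤ c) (n : ℕ) :
    ‖x ^ (n + 1) - y ^ (n + 1)‖ ≤ (n + 1) * c ^ n * ‖x - y‖ := by
  have hc : 0 ≤ c := (norm_nonneg x).trans hx
  induction n with
  | zero => simp
  | succ n ih =>
    have h1 : ‖x ^ (n + 1)‖ ≤ c ^ (n + 1) :=
      (norm_pow_le _ _).trans (pow_le_pow_left₀ (norm_nonneg _) hx _)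
    calc ‖x ^ (n + 1 + 1) - y ^ (n + 1 + 1)‖
        = ‖x ^ (n + 1) * (x - y) + (x ^ (n + 1) - y ^ (n + 1)) * y‖ := by
          rw [pow_succ x (n + 1), pow_succ y (n + 1)]; congr 1; noncomm_ring
      _ ≤ ‖x ^ (n + 1)‖ * ‖x - y‖ + ‖x ^ (n + 1) - y ^ (n + 1)‖ * ‖y‖ :=
          (norm_add_le _ _).trans (add_le_add (norm_mul_le _ _) (norm_mul_le _ _))
      _ ≤ c ^ (n + 1) * ‖x - y‖ + (n + 1) * c ^ n * ‖x - y‖ * c := by gcongr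
      _ = ((n + 1 : ℕ) + 1) * c ^ (n + 1) * ‖x - y‖ := by push_cast; ring

variable {𝔸 : Type*} [NormedRing 𝔸] [NormOneClass 𝔸] [NormedAlgebra ℝ 𝔸] [CompleteSpace 𝔸]

omit [CompleteSpace 𝔸] in
theorem norm_exp_le_exp_norm (x : 𝔸) : ‖exp x‖ ≤ Real.exp ‖x‖ := by
  rw [Real.exp_eq_exp_ℝ, exp_eq_tsum ℝ, exp_eq_tsum ℝ]
  refine tsum_of_norm_bounded (expSeries_summable' (𝕂 := ℝ) ‖x‖).hasSum fun n => ?_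
  rw [norm_smul, smul_eq_mul, Real.norm_of_nonneg (by positivity)]
  gcongr
  exact norm_pow_le _ _

/-- The Lie–Trotter product formula. -/
theorem tendsto_exp_smul_mul_exp_smul_pow (a b : 𝔸) :
    Tendsto (fun n : ℕ => (exp ((n : ℝ)⁻¹ • a) * exp ((n : ℝ)⁻¹ • b)) ^ n) atTop
      (𝓝 (exp (a + b))) := by
  let _ : NormedAlgebra ℚ 𝔸 := NormedAlgebra.restrictScalars ℚ ℝ 𝔸
  -- The two exponentials agree to first order, so each of the `n` telescoped factors contributes an
  -- error `o(1/n)`.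
  have hd : HasDerivAt (fun t : ℝ => exp (t • a) * exp (t • b) - exp (t • (a + b))) 0 0 := by
    have h1 := hasDerivAt_exp_smul_const a (0 : ℝ)
    have h2 := hasDerivAt_exp_smul_const b (0 : ℝ)
    have h3 := hasDerivAt_exp_smul_const (a + b) (0 : ℝ)
    convert! (h1.mul h2).sub h3 using 1
    simp
  have hslope := (hasDerivAt_iff_tendsto_slope_zero.1 hd).norm
  have hinv : Tendsto (fun n : ℕ => (n : ℝ)⁻¹) atTop (𝓝[≠] 0) :=
    tendsto_nhdsWithin_iff.2 ⟨tendsto_inv_atTop_nhds_zero_nat, by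
      filter_upwards [eventually_gt_atTop 0] with n hn
      simpa using hn.ne'⟩
  have hlim := (hslope.comp hinv).const_mul (Real.exp (‖a‖ + ‖b‖))
  rw [norm_zero, mul_zero] at hlim
  rw [tendsto_iff_norm_sub_tendsto_zero]
  refine squeeze_zero' (Eventually.of_forall fun _ => norm_nonneg _) ?_ hlim
  filter_upwards [eventually_gt_atTop 0] with n hn
  obtain ⟨m, rfl⟩ := Nat.exists_eq_succ_of_ne_zero hn.ne'
  have hm : (0 : ℝ) < (m : ℝ) + 1 := by positivity
  set r : ℝ := ((m.succ : ℕ) : ℝ)⁻¹ with hr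
  have hr0 : 0 < r := by rw [hr]; positivity
  have hrm : ((m : ℝ) + 1) * r = 1 := by rw [hr]; push_cast; field_simp
  have hnorm : ∀ x : 𝔸, ‖exp (r • x)‖ ≤ Real.exp (r * ‖x‖) := by
    intro x
    refine (norm_exp_le_exp_norm _).trans (Real.exp_le_exp.2 ?_)
    rw [norm_smul, Real.norm_of_nonneg hr0.le]
  have hX : ‖exp (r • a) * exp (r • b)‖ ≤ Real.exp (r * (‖a‖ + ‖b‖)) := by
    rw [mul_add, Real.exp_add]
    exact (norm_mul_le _ _).trans
      (mul_le_mul (hnorm a) (hnorm b) (norm_nonneg _) (Real.exp_pos _).le)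
  have hY : ‖exp (r • (a + b))‖ ≤ Real.exp (r * (‖a‖ + ‖b‖)) := by
    refine (hnorm _).trans (Real.exp_le_exp.2 ?_)
    gcongr
    exact norm_add_le _ _
  have hpow : exp (a + b) = exp (r • (a + b)) ^ (m + 1) := by
    rw [← NormedSpace.exp_nsmul, ← Nat.cast_smul_eq_nsmul ℝ, smul_smul]
    push_cast
    rw [hrm, one_smul]
  have hK : Real.exp (r * (‖a‖ + ‖b‖)) ^ m ≤ Real.exp (‖a‖ + ‖b‖) := by
    rw [← Real.exp_nat_mul]
    apply Real.exp_le_exp.2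
    have : (m : ℝ) * r ≤ 1 := by linarith
    have h0 : 0 ≤ ‖a‖ + ‖b‖ := by positivity
    nlinarith
  rw [hpow]
  refine (norm_pow_sub_pow_le hX hY m).trans ?_
  simp only [Function.comp_apply, zero_add, zero_smul, exp_zero, mul_one, sub_self, sub_zero,
    norm_smul, ← hr]
  rw [norm_inv, Real.norm_of_nonneg hr0.le, hr, inv_inv, ← hr]
  push_cast
  calc _ ≤ ((m : ℝ) + 1) * Real.exp (‖a‖ + ‖b‖) * _ := by gcongr
    _ = _ := by ring

end LieTrotter

open scoped Matrix.Norms.Operator in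
/-- The Golden–Thompson inequality for real symmetric matrices. -/
theorem Matrix.trace_exp_add_le {n : Type*} [Fintype n] [DecidableEq n] {A B : Matrix n n ℝ}
    (hA : Aᵀ = A) (hB : Bᵀ = B) :
    (NormedSpace.exp (A + B)).trace ≤ (NormedSpace.exp A * NormedSpace.exp B).trace := by
  rcases isEmpty_or_nonempty n with hn | hn
  · simp [trace]
  have h2 : Filter.Tendsto (fun j : ℕ => 2 ^ j) Filter.atTop Filter.atTop :=
    tendsto_pow_atTop_atTop_of_one_lt one_lt_two
  have h1 := (tendsto_exp_smul_mul_exp_smul_pow A B).comp h2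
  have hc : Continuous (trace : Matrix n n ℝ → ℝ) := continuous_id.matrix_trace
  refine le_of_tendsto ((hc.tendsto _).comp h1) (Filter.Eventually.of_forall fun j => ?_)
  have hs : ∀ C : Matrix n n ℝ, Cᵀ = C →
      (NormedSpace.exp ((((2 ^ j : ℕ) : ℝ))⁻¹ • C))ᵀ
        = NormedSpace.exp ((((2 ^ j : ℕ) : ℝ))⁻¹ • C) := by
    intro C hC
    rw [← exp_transpose, transpose_smul, hC]
  have hp : ∀ C : Matrix n n ℝ,
      NormedSpace.exp ((((2 ^ j : ℕ) : ℝ))⁻¹ • C) ^ 2 ^ j = NormedSpace.exp C := by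
    intro C
    rw [← Matrix.exp_nsmul, ← Nat.cast_smul_eq_nsmul ℝ, smul_smul, mul_inv_cancel₀ (by positivity),
      one_smul]
  have := (trace_pow_two_pow_aux j).2 _ _ (hs A hA) (hs B hB)
  rw [hp, hp] at this
  exact this

/-! ### Second-order estimates for traces of exponentials. -/

/-- For `y ≤ -1` the left side is at most `1` and `y + y² ≥ 0`; hence no lower bound on the spectrum
is needed later. -/
theorem Real.exp_le_one_add_add_sq {y : ℝ} (hy : y ≤ 1) : Real.exp y ≤ 1 + y + y ^ 2 := by
  rcases le_total (-1) y with h | h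
  · have := (abs_le.1 (Real.abs_exp_sub_one_sub_id_le (abs_le.2 ⟨h, hy⟩))).2
    linarith
  · have : Real.exp y ≤ 1 := Real.exp_le_one_iff.2 (by linarith)
    nlinarith

namespace Matrix

variable {n : Type*} [Fintype n] [DecidableEq n]

/-- One `U` serves both `A` and `exp A`, which reduces the trace estimates to scalar ones on
eigenvalues. -/
theorem exists_orthogonal_diagonalization {A : Matrix n n ℝ} (hA : Aᵀ = A) :
    ∃ (U : Matrix n n ℝ) (l : n → ℝ), Uᵀ * U = 1 ∧ A = U * diagonal l * Uᵀ ∧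
      NormedSpace.exp A = U * diagonal (fun i => Real.exp (l i)) * Uᵀ := by
  have hA' : A.IsHermitian := by rw [IsHermitian, conjTranspose_eq_transpose_of_trivial, hA]
  have h1 := hA'.spectral_theorem
  rw [Unitary.conjStarAlgAut_apply, star_eq_conjTranspose,
    conjTranspose_eq_transpose_of_trivial] at h1
  set U : Matrix n n ℝ := ↑hA'.eigenvectorUnitary with hU
  have hUU : Uᵀ * U = 1 := by
    have := (mem_unitaryGroup_iff' (A := U)).1 hA'.eigenvectorUnitary.2
    rwa [star_eq_conjTranspose, conjTranspose_eq_transpose_of_trivial] at this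
  have hinv : U⁻¹ = Uᵀ := inv_eq_left_inv hUU
  have hunit : IsUnit U := IsUnit.of_mul_eq_one_right _ hUU
  refine ⟨U, hA'.eigenvalues, hUU, h1, ?_⟩
  conv_lhs => rw [h1]
  rw [← hinv, exp_conj _ _ hunit, exp_diagonal]
  congr 3
  ext i
  rw [Pi.coe_exp]
  simp [Real.exp_eq_exp_ℝ]

theorem dotProduct_conj_diagonal_mulVec (U : Matrix n n ℝ) (l v : n → ℝ) :
    v ⬝ᵥ ((U * diagonal l * Uᵀ) *ᵥ v) = ∑ i, l i * (Uᵀ *ᵥ v) i ^ 2 := by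
  rw [← mulVec_mulVec, ← mulVec_mulVec, dotProduct_mulVec, ← mulVec_transpose, dotProduct]
  refine Finset.sum_congr rfl fun i _ => ?_
  rw [mulVec_diagonal]; ring

theorem sum_sq_transpose_mulVec {U : Matrix n n ℝ} (hU : Uᵀ * U = 1) (v : n → ℝ) :
    ∑ i, (Uᵀ *ᵥ v) i ^ 2 = v ⬝ᵥ v := by
  have h := dotProduct_conj_diagonal_mulVec U (fun _ => 1) v
  rw [diagonal_one, mul_one, mul_eq_one_comm.1 hU, one_mulVec] at h
  simpa using h.symm

theorem trace_mul_conj_diagonal (W U : Matrix n n ℝ) (l : n → ℝ) :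
    (W * (U * diagonal l * Uᵀ)).trace = ∑ i, l i * (Uᵀ i ⬝ᵥ (W *ᵥ Uᵀ i)) := by
  rw [← mul_assoc, ← mul_assoc, trace_mul_comm, ← mul_assoc, ← mul_assoc, trace]
  refine Finset.sum_congr rfl fun i _ => ?_
  rw [diag_apply, mul_diagonal, mul_comm]
  congr 1
  rw [mul_assoc, mul_apply]
  rfl

theorem trace_conj_diagonal {U : Matrix n n ℝ} (hU : Uᵀ * U = 1) (l : n → ℝ) :
    (U * diagonal l * Uᵀ).trace = ∑ i, l i := by
  rw [mul_assoc, trace_mul_comm, mul_assoc, hU, mul_one, trace_diagonal]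

theorem posDef_exp {A : Matrix n n ℝ} (hA : Aᵀ = A) : (NormedSpace.exp A).PosDef := by
  obtain ⟨U, l, hU, -, h⟩ := exists_orthogonal_diagonalization hA
  have hs : (NormedSpace.exp A).IsHermitian := by
    rw [IsHermitian, conjTranspose_eq_transpose_of_trivial, ← exp_transpose, hA]
  refine .of_dotProduct_mulVec_pos hs fun x hx => ?_
  rw [star_trivial, h, dotProduct_conj_diagonal_mulVec]
  have hx' : 0 < ∑ i, (Uᵀ *ᵥ x) i ^ 2 := by
    rw [sum_sq_transpose_mulVec hU]
    simpa using dotProduct_self_star_pos_iff.2 hx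
  obtain ⟨i, hi, hi'⟩ := Finset.exists_lt_of_sum_lt (s := Finset.univ) (f := fun _ => (0 : ℝ))
    (by simpa using hx')
  exact Finset.sum_pos' (fun j _ => by positivity) ⟨i, hi, by positivity⟩

/-- Log-sum-exp of the eigenvalues dominates the largest one. -/
theorem dotProduct_mulVec_le_log_trace_exp {A : Matrix n n ℝ} (hA : Aᵀ = A) (v : n → ℝ) :
    v ⬝ᵥ (A *ᵥ v) ≤ Real.log (NormedSpace.exp A).trace * (v ⬝ᵥ v) := by
  obtain ⟨U, l, hU, h1, h2⟩ := exists_orthogonal_diagonalization hA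
  rw [h2, trace_conj_diagonal hU, h1, dotProduct_conj_diagonal_mulVec,
    ← sum_sq_transpose_mulVec hU, Finset.mul_sum]
  gcongr with i
  rw [← Real.log_exp (l i)]
  refine Real.log_le_log (Real.exp_pos _) ?_
  exact Finset.single_le_sum (f := fun i => Real.exp (l i)) (fun j _ => (Real.exp_pos _).le)
    (Finset.mem_univ i)

/-- In an eigenbasis of `B` the diagonal of `W` is nonnegative and weights the scalar inequality at
each eigenvalue. -/
theorem trace_mul_exp_le {W B : Matrix n n ℝ} (hW : W.PosSemidef) (hB : Bᵀ = B)
    (hle : ∀ v, v ⬝ᵥ (B *ᵥ v) ≤ v ⬝ᵥ v) :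
    (W * NormedSpace.exp B).trace ≤ W.trace + (W * B).trace + (W * (B * B)).trace := by
  obtain ⟨U, l, hU, h1, h2⟩ := exists_orthogonal_diagonalization hB
  have hl : ∀ i, l i ≤ 1 := by
    intro i
    have h := hle (U *ᵥ Pi.single i 1)
    rw [h1, dotProduct_conj_diagonal_mulVec, ← sum_sq_transpose_mulVec hU, mulVec_mulVec, hU,
      one_mulVec] at h
    simpa [Pi.single_apply] using h
  have h3 : B * B = U * diagonal (fun i => l i ^ 2) * Uᵀ := by
    rw [h1, show U * diagonal l * Uᵀ * (U * diagonal l * Uᵀ)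
      = U * (diagonal l * (Uᵀ * U) * diagonal l) * Uᵀ by simp only [mul_assoc], hU, mul_one,
      diagonal_mul_diagonal]
    simp only [pow_two]
  have h4 : W.trace = (W * (U * diagonal (fun _ => (1 : ℝ)) * Uᵀ)).trace := by
    rw [diagonal_one, mul_one, mul_eq_one_comm.1 hU, mul_one]
  rw [h4, h3, h2, h1]
  simp only [trace_mul_conj_diagonal, ← Finset.sum_add_distrib, ← add_mul]
  gcongr with i
  · simpa using hW.dotProduct_mulVec_nonneg (Uᵀ i)
  · exact Real.exp_le_one_add_add_sq (hl i)

omit [DecidableEq n] in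
theorem trace_mul_vecMulVec (W : Matrix n n ℝ) (x y : n → ℝ) :
    (W * vecMulVec x y).trace = y ⬝ᵥ (W *ᵥ x) := by
  rw [mul_vecMulVec, trace_vecMulVec, dotProduct_comm]

omit [DecidableEq n] in
theorem PosSemidef.diag_le_trace {W : Matrix n n ℝ} (hW : W.PosSemidef) (i : n) :
    W i i ≤ W.trace :=
  Finset.single_le_sum (f := fun i => W i i) (fun _ _ => hW.diag_nonneg) (Finset.mem_univ i)

theorem PosSemidef.abs_apply_le {W : Matrix n n ℝ} (hW : W.PosSemidef) (i j : n) {c : ℝ}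
    (hc : ∀ i, W i i ≤ c) : |W i j| ≤ c := by
  have hs : W j i = W i j := by simpa using hW.1.apply i j
  -- Testing on `eᵢ ± eⱼ` gives `2|W i j| ≤ W i i + W j j`.
  have h1 := hW.dotProduct_mulVec_nonneg (Pi.single i 1 + Pi.single j 1)
  have h2 := hW.dotProduct_mulVec_nonneg (Pi.single i 1 - Pi.single j 1)
  simp [mulVec_add, mulVec_sub, add_dotProduct, sub_dotProduct] at h1 h2
  rw [abs_le]
  constructor <;> linarith [hc i, hc j]

/-- The growth of the potential `tr (exp A)` when `-η (a 1ᵢ - g gᵀ)` is added to `A`. -/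
theorem trace_mul_exp_rankOne_update_le {W : Matrix n n ℝ} (hW : W.PosSemidef) (i : n)
    (g : n → ℝ) {a ε η : ℝ} (ha : 0 < a) (hε : 0 < ε) (hη : 0 ≤ η) (hηa : 2 * η * a ≤ ε)
    (hpos : 0 < W i i)
    (hg : g ⬝ᵥ (W *ᵥ g) + ε * W i i * (g ⬝ᵥ g) ≤ a * W i i) :
    (W * NormedSpace.exp (-η • (a • single i i (1 : ℝ) - vecMulVec g g))).trace
      ≤ (1 + 2 * η ^ 2 * a ^ 2) * W.trace := by
  set B : Matrix n n ℝ := -η • (a • single i i (1 : ℝ) - vecMulVec g g) with hB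
  have hBs : Bᵀ = B := by
    simp [hB, transpose_smul, transpose_sub, transpose_vecMulVec]
  have hq0 : 0 ≤ g ⬝ᵥ (W *ᵥ g) := by simpa using hW.dotProduct_mulVec_nonneg g
  have hgg : 0 ≤ g ⬝ᵥ g := Finset.sum_nonneg fun j _ => mul_self_nonneg _
  have hgi : g i ^ 2 ≤ g ⬝ᵥ g := by
    rw [pow_two]
    exact Finset.single_le_sum (f := fun j => g j * g j) (fun j _ => mul_self_nonneg _)
      (Finset.mem_univ i)
  have hεg : ε * (g ⬝ᵥ g) ≤ a := by
    refine le_of_mul_le_mul_right ?_ hpos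
    linarith
  have hηg : η * (g ⬝ᵥ g) ≤ 1 := by
    have : ε * (η * (g ⬝ᵥ g)) ≤ ε * 1 := by nlinarith
    exact le_of_mul_le_mul_left this hε
  have hle : ∀ v, v ⬝ᵥ (B *ᵥ v) ≤ v ⬝ᵥ v := by
    intro v
    have hcs : (g ⬝ᵥ v) ^ 2 ≤ (g ⬝ᵥ g) * (v ⬝ᵥ v) := by
      simpa [dotProduct, pow_two] using Finset.sum_mul_sq_le_sq_mul_sq Finset.univ g v
    have hv : 0 ≤ v ⬝ᵥ v := Finset.sum_nonneg fun j _ => mul_self_nonneg _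
    have e : v ⬝ᵥ (B *ᵥ v) = -η * (a * v i ^ 2 - (g ⬝ᵥ v) ^ 2) := by
      rw [hB, smul_mulVec, sub_mulVec, smul_mulVec, vecMulVec_mulVec, dotProduct_smul,
        dotProduct_sub, dotProduct_smul]
      simp [dotProduct_comm v g, pow_two, single_mulVec]
      simp [dotProduct, Function.update_apply]
    rw [e]
    have h1 : 0 ≤ η * (a * v i ^ 2) := by positivity
    have h2 : η * (g ⬝ᵥ v) ^ 2 ≤ η * ((g ⬝ᵥ g) * (v ⬝ᵥ v)) := by gcongr
    nlinarith
  have hs : vecMulVec (Pi.single i (1 : ℝ)) (Pi.single i (1 : ℝ)) = single i i (1 : ℝ) := by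
    rw [single_eq_single_vecMulVec_single]
  have hWi : (Pi.single i (1:ℝ)) ⬝ᵥ (W *ᵥ (Pi.single i (1:ℝ))) = W i i := by simp
  have hWsym : ∀ x y : n → ℝ, x ⬝ᵥ (W *ᵥ y) = y ⬝ᵥ (W *ᵥ x) := by
    intro x y
    have : Wᵀ = W := (conjTranspose_eq_transpose_of_trivial W).symm.trans hW.1
    rw [dotProduct_mulVec, ← mulVec_transpose, this, dotProduct_comm]
  have hWB : (W * B).trace = -η * (a * W i i - g ⬝ᵥ (W *ᵥ g)) := by
    rw [hB, ← hs]
    simp only [mul_smul_comm, mul_sub, trace_smul, trace_sub, trace_mul_vecMulVec, smul_eq_mul, hWi]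
  set r := Pi.single i (1:ℝ) ⬝ᵥ (W *ᵥ g) with hr
  have hWBB : (W * (B * B)).trace
      = η ^ 2 * (a ^ 2 * W i i - 2 * (a * g i * r) + (g ⬝ᵥ g) * (g ⬝ᵥ (W *ᵥ g))) := by
    rw [hB, ← hs]
    simp only [mul_smul_comm, smul_mul_assoc, mul_sub, sub_mul, trace_smul, trace_sub,
      vecMulVec_mul_vecMulVec, trace_mul_vecMulVec, smul_eq_mul, hWi, smul_dotProduct,
      hWsym g (Pi.single i 1), ← hr]
    simp
    ring
  -- Positivity at `a eᵢ + gᵢ g` controls the cross term of `tr(WB²)`, whose sign is unknown.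
  have hmix : 0 ≤ a ^ 2 * W i i + 2 * (a * g i * r) + g i ^ 2 * (g ⬝ᵥ (W *ᵥ g)) := by
    have := hW.dotProduct_mulVec_nonneg (a • Pi.single i (1:ℝ) + g i • g)
    simp only [star_trivial, mulVec_add, mulVec_smul, add_dotProduct, smul_dotProduct,
      dotProduct_add, dotProduct_smul, smul_eq_mul, hWi, hWsym g (Pi.single i 1), ← hr] at this
    linarith
  refine (trace_mul_exp_le hW hBs hle).trans ?_
  rw [hWB, hWBB]
  have h1 : g i ^ 2 * (g ⬝ᵥ (W *ᵥ g)) ≤ (g ⬝ᵥ g) * (g ⬝ᵥ (W *ᵥ g)) := by gcongr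
  have h2 : g ⬝ᵥ (W *ᵥ g) ≤ a * W i i := by nlinarith [mul_nonneg (mul_nonneg hε.le hpos.le) hgg]
  have h3 : 2 * η ^ 2 * a ^ 2 * W i i ≤ 2 * η ^ 2 * a ^ 2 * W.trace := by
    gcongr
    exact hW.diag_le_trace i
  have h4 : η ^ 2 * (g ⬝ᵥ g) * (g ⬝ᵥ (W *ᵥ g)) ≤ η ^ 2 * (g ⬝ᵥ g) * (a * W i i) := by gcongr
  -- With `h4`, the `|g|²` part of the second-order term is at most `ηε W i i |g|²`, exactly the
  -- slack that `h6` leaves in the first-order term.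
  have h5 : η * (g ⬝ᵥ g) * W i i * (2 * η * a) ≤ η * (g ⬝ᵥ g) * W i i * ε := by gcongr
  have h6 : η * (g ⬝ᵥ (W *ᵥ g) + ε * W i i * (g ⬝ᵥ g)) ≤ η * (a * W i i) := by gcongr
  have h7 : η ^ 2 * (-2 * (a * g i * r)) ≤
      η ^ 2 * (a ^ 2 * W i i + (g ⬝ᵥ g) * (g ⬝ᵥ (W *ᵥ g))) := by
    gcongr
    linarith
  linarith

end Matrix

/-! ### Parameter estimates. -/

namespace MultiFlow

theorem eps1_eq {k : ℕ} (hk : 0 < k) (ε : ℝ) : eps1 k ε = √ε / (k * √k) := by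
  have hk' : (0 : ℝ) < k := by exact_mod_cast hk
  rw [eps1, show (3 / 2 : ℝ) = 1 + 1 / 2 by norm_num, Real.rpow_add hk', Real.rpow_one,
    ← Real.sqrt_eq_rpow, ← Real.sqrt_eq_rpow]

theorem width_pos {k : ℕ} (hk : 0 < k) {ε : ℝ} (hε : 0 < ε) : 0 < width k ε :=
  Real.sqrt_pos.2 (by positivity)

theorem eps1_div_width {k : ℕ} (hk : 0 < k) {ε : ℝ} (hε : 0 < ε) :
    eps1 k ε / width k ε = ε / k ^ 2 := by
  have hk' : (0 : ℝ) < k := by exact_mod_cast hk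
  have h1 : √(k : ℝ) ^ 2 = k := Real.sq_sqrt hk'.le
  have h2 : √ε ^ 2 = ε := Real.sq_sqrt hε.le
  have h3 : 0 < √(k : ℝ) := Real.sqrt_pos.2 hk'
  have h4 : 0 < √ε := Real.sqrt_pos.2 hε
  rw [eps1_eq hk, width, Real.sqrt_div hk'.le, div_div_eq_mul_div, div_mul_eq_mul_div, div_div,
    ← pow_two, h2, mul_assoc, ← pow_two, h1, ← pow_two]

theorem eps1_pos {k : ℕ} (hk : 0 < k) {ε : ℝ} (hε : 0 < ε) : 0 < eps1 k ε := by
  have hk' : (0 : ℝ) < k := by exact_mod_cast hk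
  unfold eps1; positivity

theorem eps1_le {k : ℕ} (hk : 2 ≤ k) {ε : ℝ} (hε1 : ε ≤ 1) : eps1 k ε ≤ 3 / 8 := by
  have hk' : (2 : ℝ) ≤ k := by exact_mod_cast hk
  have h1 : √ε ≤ 1 := Real.sqrt_le_one.2 hε1
  have h2 : (4 / 3 : ℝ) ≤ √k := Real.le_sqrt_of_sq_le (by norm_num; linarith)
  rw [eps1_eq (by omega), div_le_iff₀ (by positivity)]
  nlinarith

/-- With `y = 4x/3`, the upper bound follows from `(1 - x)(1 + y + y²/2) ≥ 1`, valid up to `3/8`. -/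
theorem neg_log_one_sub_bounds {x : ℝ} (h0 : 0 ≤ x) (h1 : x ≤ 3 / 8) :
    x ≤ -Real.log (1 - x) ∧ -Real.log (1 - x) ≤ 4 / 3 * x := by
  constructor
  · linarith [Real.log_le_sub_one_of_pos (show 0 < 1 - x by linarith)]
  · rw [← Real.log_inv, Real.log_le_iff_le_exp (by simp; linarith)]
    refine le_trans ?_ (Real.quadratic_le_exp_of_nonneg (by linarith : 0 ≤ 4 / 3 * x))
    rw [inv_le_iff_one_le_mul₀ (by linarith)]
    nlinarith [mul_nonneg h0 h0, mul_nonneg h0 (sub_nonneg.2 h1),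
      mul_nonneg (mul_nonneg h0 h0) (sub_nonneg.2 h1)]

theorem rate_bounds {k : ℕ} (hk : 2 ≤ k) {ε : ℝ} (hε : 0 < ε) (hε1 : ε ≤ 1) :
    ε / (2 * k ^ 2) ≤ eps1' k ε / (2 * width k ε) ∧
      eps1' k ε / (2 * width k ε) ≤ 2 / 3 * (ε / k ^ 2) := by
  have hk0 : 0 < k := by omega
  have hw := width_pos hk0 hε
  obtain ⟨h1, h2⟩ := neg_log_one_sub_bounds (eps1_pos hk0 hε).le (eps1_le hk hε1)
  rw [← eps1'] at h1 h2
  have h := eps1_div_width hk0 hε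
  have e1 : ε / (2 * k ^ 2) = eps1 k ε / (2 * width k ε) := by
    rw [mul_comm (2 : ℝ), mul_comm (2 : ℝ), ← div_div, ← div_div, h]
  have e2 : 2 / 3 * (ε / k ^ 2) = 4 / 3 * eps1 k ε / (2 * width k ε) := by
    rw [← h]; field_simp; ring
  rw [e1, e2]
  constructor <;> gcongr

/-- The initial potential costs at most `2εN`, and `kη ≤ ε/3` bounds the second-order loss. Only `N
≥ k³ε⁻² ln k` enters. -/
theorem averaged_energy_bound {k : ℕ} (hk : 2 ≤ k) {ε η : ℝ} (hε : 0 < ε) (hε1 : ε ≤ 1)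
    (h1 : ε / (2 * k ^ 2) ≤ η) (h2 : η ≤ 2 / 3 * (ε / k ^ 2)) {N : ℕ}
    (hN : (k : ℝ) ^ (7 / 2 : ℝ) * ε ^ (-(5 / 2) : ℝ) * Real.log k ≤ N) :
    (1 + 2 * ε) * N + k * Real.log k / η + 2 * k * η * (1 + 2 * ε) ^ 2 * N
      ≤ N * (1 + 3 * ε) ^ 2 := by
  have hk' : (2 : ℝ) ≤ k := by exact_mod_cast hk
  have hL : 0 ≤ Real.log k := Real.log_nonneg (by linarith)
  have hN0 : (0 : ℝ) ≤ N := Nat.cast_nonneg N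
  have e1 : (k : ℝ) ^ 3 ≤ (k : ℝ) ^ (7 / 2 : ℝ) := by
    rw [← Real.rpow_natCast]
    exact Real.rpow_le_rpow_of_exponent_le (by linarith) (by norm_num)
  have e2 : (ε ^ 2)⁻¹ ≤ ε ^ (-(5 / 2) : ℝ) := by
    rw [← Real.rpow_natCast, ← Real.rpow_neg hε.le]
    exact Real.rpow_le_rpow_of_exponent_ge hε hε1 (by norm_num)
  have e3 : (k : ℝ) ^ 3 * Real.log k ≤ N * ε ^ 2 := by
    have : (k : ℝ) ^ 3 * (ε ^ 2)⁻¹ * Real.log k ≤ N := le_trans (by gcongr) hN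
    rw [mul_right_comm, ← div_eq_mul_inv, div_le_iff₀ (by positivity)] at this
    exact this
  have e4 : k * Real.log k / η ≤ 2 * N * ε := by
    calc k * Real.log k / η ≤ k * Real.log k / (ε / (2 * k ^ 2)) := by gcongr
      _ = 2 * (k ^ 3 * Real.log k) / ε := by field_simp
      _ ≤ 2 * (N * ε ^ 2) / ε := by gcongr
      _ = 2 * N * ε := by field_simp
  have e5 : k * η ≤ ε / 3 := by
    calc k * η ≤ k * (2 / 3 * (ε / k ^ 2)) := by gcongr
      _ = 2 / 3 * (ε / k) := by field_simp
      _ ≤ 2 / 3 * (ε / 2) := by gcongr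
      _ = ε / 3 := by ring
  have e6 : 2 * k * η * (1 + 2 * ε) ^ 2 * N ≤ 2 * (ε / 3) * (1 + 2 * ε) ^ 2 * N := by
    rw [mul_assoc 2]
    gcongr
  have e7 : (1 + 2 * ε) + 2 * ε + 2 * (ε / 3) * (1 + 2 * ε) ^ 2 ≤ (1 + 3 * ε) ^ 2 := by
    nlinarith [mul_nonneg hε.le (sub_nonneg.2 hε1), mul_nonneg (sq_nonneg ε) (sub_nonneg.2 hε1)]
  nlinarith

/-! ### The energy matrices and the oracle contract. -/

section MaxEntry

variable {k : ℕ} {W : Matrix (Fin k) (Fin k) ℝ}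

theorem le_maxEntry (i j : Fin k) : |W i j| ≤ maxEntry W :=
  (le_ciSup (f := fun j => |W i j|) (Finite.bddAbove_range _) j).trans
    (le_ciSup (f := fun i => ⨆ j, |W i j|) (Finite.bddAbove_range _) i)

/-- This identifies the normalisation in the query with the diagonal entry selected in the update.
-/
theorem maxEntry_eq (hW : W.PosSemidef) {i : Fin k} (hi : ∀ j, W j j ≤ W i i) :
    maxEntry W = W i i := by
  have : Nonempty (Fin k) := ⟨i⟩
  refine le_antisymm (ciSup_le fun j => ciSup_le fun l => hW.abs_apply_le j l hi) ?_
  exact (le_abs_self _).trans (le_maxEntry i i)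

theorem maxEntry_pos (hW : W.PosDef) (i : Fin k) : 0 < maxEntry W :=
  hW.diag_pos.trans_le ((le_abs_self _).trans (le_maxEntry i i))

theorem dotProduct_energyMatrix_mulVec (ε u : ℝ) (W : Matrix (Fin k) (Fin k) ℝ)
    (f : Fin k → ℝ) :
    f ⬝ᵥ (energyMatrix ε u W *ᵥ f)
      = 1 / u ^ 2 * (1 / maxEntry W * (f ⬝ᵥ (W *ᵥ f)) + ε * (f ⬝ᵥ f)) := by
  simp only [energyMatrix, smul_mulVec, add_mulVec, one_mulVec, dotProduct_smul, dotProduct_add,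
    smul_eq_mul]

theorem dotProduct_mulVec_le_maxEntry (W : Matrix (Fin k) (Fin k) ℝ) (f : Fin k → ℝ) :
    f ⬝ᵥ (W *ᵥ f) ≤ maxEntry W * (∑ i, |f i|) ^ 2 := by
  have : f ⬝ᵥ (W *ᵥ f) = ∑ i, ∑ j, f i * (W i j * f j) := by
    simp [dotProduct, mulVec, Finset.mul_sum]
  rw [this, pow_two, Finset.sum_mul_sum, Finset.mul_sum]
  refine Finset.sum_le_sum fun i _ => ?_
  rw [Finset.mul_sum]
  refine Finset.sum_le_sum fun j _ => (le_abs_self _).trans ?_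
  rw [abs_mul, abs_mul]
  calc |f i| * (|W i j| * |f j|) ≤ |f i| * (maxEntry W * |f j|) := by
        gcongr; exact le_maxEntry i j
    _ = _ := by ring

theorem dotProduct_self_le_sq_sum_abs (f : Fin k → ℝ) : f ⬝ᵥ f ≤ (∑ i, |f i|) ^ 2 := by
  have := Finset.sum_sq_le_sq_sum_of_nonneg (s := Finset.univ) (f := fun i => |f i|)
    (fun i _ => abs_nonneg _)
  simpa [dotProduct, pow_two] using this

theorem sq_sum_abs_le (f : Fin k → ℝ) : (∑ i, |f i|) ^ 2 ≤ k * (f ⬝ᵥ f) := by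
  have := sq_sum_le_card_mul_sum_sq (s := Finset.univ) (f := fun i => |f i|)
  simpa [dotProduct, pow_two] using this

theorem energy_le_of_l1_le {ε u : ℝ} (hε : 0 ≤ ε) (hu : 0 < u) (hW : 0 < maxEntry W)
    {f : Fin k → ℝ} (hf : ∑ i, |f i| ≤ u) : f ⬝ᵥ (energyMatrix ε u W *ᵥ f) ≤ 1 + ε := by
  have h0 : (∑ i, |f i|) ^ 2 ≤ u ^ 2 :=
    pow_le_pow_left₀ (Finset.sum_nonneg fun i _ => abs_nonneg _) hf 2
  have h1 : 1 / maxEntry W * (f ⬝ᵥ (W *ᵥ f)) ≤ u ^ 2 := by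
    rw [one_div, inv_mul_le_iff₀ hW]
    exact (dotProduct_mulVec_le_maxEntry W f).trans (by gcongr)
  have h2 : f ⬝ᵥ f ≤ u ^ 2 := (dotProduct_self_le_sq_sum_abs f).trans h0
  rw [dotProduct_energyMatrix_mulVec, one_div, inv_mul_le_iff₀ (by positivity)]
  nlinarith

theorem normalized_energy_le {ε u b : ℝ} (hu : 0 < u) (hW : W.PosDef) {i : Fin k}
    (hi : ∀ j, W j j ≤ W i i) {f : Fin k → ℝ} (hf : f ⬝ᵥ (energyMatrix ε u W *ᵥ f) ≤ b) :
    (u⁻¹ • f) ⬝ᵥ (W *ᵥ (u⁻¹ • f)) + ε * W i i * ((u⁻¹ • f) ⬝ᵥ (u⁻¹ • f)) ≤ b * W i i := by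
  have hpos : 0 < W i i := hW.diag_pos
  rw [dotProduct_energyMatrix_mulVec, maxEntry_eq hW.posSemidef hi] at hf
  have h := mul_le_mul_of_nonneg_right hf hpos.le
  simp only [mulVec_smul, dotProduct_smul, smul_dotProduct, smul_eq_mul]
  refine le_trans (le_of_eq ?_) h
  field_simp

theorem wellConditioned_energyMatrix {E : Type*} {ε : ℝ} (hk : 0 < k) (hε : 0 < ε) (hε1 : ε ≤ 1)
    {u : E → ℝ} (hu : ∀ e, 0 < u e) {W : E → Matrix (Fin k) (Fin k) ℝ}
    (hW : ∀ e, (W e).PosDef) :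
    WellConditioned (2 * k / ε) fun e => energyMatrix ε (u e) (W e) := by
  intro e
  have hu' := hu e
  have hmax : 0 < maxEntry (W e) := maxEntry_pos (hW e) ⟨0, hk⟩
  have hk1 : (1 : ℝ) ≤ k := by exact_mod_cast hk
  have hH : ∀ c : ℝ, (c • (1 : Matrix (Fin k) (Fin k) ℝ)).IsHermitian := fun c =>
    (isHermitian_one).smul (IsSelfAdjoint.all c)
  have hP : (energyMatrix ε (u e) (W e)).IsHermitian :=
    ((((hW e).1.smul (IsSelfAdjoint.all _)).add (hH ε)).smul (IsSelfAdjoint.all _))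
  -- The eigenvalues of `u²P` lie between `ε` and `k + ε ≤ 2k`.
  refine ⟨ε / u e ^ 2, by positivity, ?_, ?_⟩
  · refine .of_dotProduct_mulVec_nonneg (hP.sub (hH _)) fun x => ?_
    have h0 : 0 ≤ x ⬝ᵥ (W e *ᵥ x) := by
      simpa using (hW e).posSemidef.dotProduct_mulVec_nonneg x
    rw [star_trivial, sub_mulVec, dotProduct_sub, dotProduct_energyMatrix_mulVec, smul_mulVec,
      one_mulVec, dotProduct_smul, smul_eq_mul]
    have : 0 ≤ 1 / u e ^ 2 * (1 / maxEntry (W e) * (x ⬝ᵥ (W e *ᵥ x))) := by positivity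
    refine this.trans (le_of_eq ?_)
    ring
  · refine .of_dotProduct_mulVec_nonneg ((hH _).sub hP) fun x => ?_
    have hxx : 0 ≤ x ⬝ᵥ x := Finset.sum_nonneg fun j _ => mul_self_nonneg _
    have h1 : 1 / maxEntry (W e) * (x ⬝ᵥ (W e *ᵥ x)) ≤ k * (x ⬝ᵥ x) := by
      rw [one_div, inv_mul_le_iff₀ hmax]
      exact (dotProduct_mulVec_le_maxEntry _ x).trans (by gcongr; exact sq_sum_abs_le x)
    rw [star_trivial, sub_mulVec, dotProduct_sub, dotProduct_energyMatrix_mulVec, smul_mulVec,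
      one_mulVec, dotProduct_smul, smul_eq_mul, sub_nonneg]
    calc 1 / u e ^ 2 * (1 / maxEntry (W e) * (x ⬝ᵥ (W e *ᵥ x)) + ε * (x ⬝ᵥ x))
        ≤ 1 / u e ^ 2 * (k * (x ⬝ᵥ x) + k * (x ⬝ᵥ x)) := by
          gcongr; exact hε1.trans hk1
      _ = 2 * k / ε * (ε / u e ^ 2) * (x ⬝ᵥ x) := by field_simp; ring

end MaxEntry

/-! ### One round of the update. -/

section Potential

variable {k : ℕ}

theorem exp_add_smul_one (A : Matrix (Fin k) (Fin k) ℝ) (c : ℝ) :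
    NormedSpace.exp (A + c • (1 : Matrix (Fin k) (Fin k) ℝ))
      = Real.exp c • NormedSpace.exp A := by
  rw [exp_add_of_commute _ _ ((Commute.one_right A).smul_right c), smul_one_eq_diagonal,
    exp_diagonal, show NormedSpace.exp (fun _ : Fin k => c) = fun _ => Real.exp c from
      funext fun _ => by rw [Pi.coe_exp, Real.exp_eq_exp_ℝ], ← smul_one_eq_diagonal, mul_smul_comm, mul_one]

theorem lossMatrix_eq (hk : 0 < k) {ε : ℝ} (hε : 0 < ε) (u : ℝ) (i : Fin k) (f : Fin k → ℝ) :
    lossMatrix ε u i f = (1 / (2 * width k ε)) • ((1 + 2 * ε) • single i i (1 : ℝ)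
      - vecMulVec (u⁻¹ • f) (u⁻¹ • f)) + (1 / 2 : ℝ) • (1 : Matrix (Fin k) (Fin k) ℝ) := by
  have hw := width_pos hk hε
  have hu : 1 / u ^ 2 = u⁻¹ * u⁻¹ := by rw [one_div, pow_two, mul_inv]
  rw [lossMatrix, hu]
  generalize u⁻¹ = v
  ext a b
  simp only [Matrix.smul_apply, Matrix.add_apply, Matrix.sub_apply, vecMulVec_apply, Pi.smul_apply, smul_eq_mul]
  field_simp

theorem transpose_lossMatrix (ε u : ℝ) (i : Fin k) (f : Fin k → ℝ) :
    (lossMatrix ε u i f)ᵀ = lossMatrix ε u i f := by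
  simp [lossMatrix, transpose_vecMulVec]

/-- The identity part of the loss commutes with everything and factors out as a scalar;
Golden–Thompson splits off the rest. -/
theorem trace_exp_update_le (hk : 0 < k) {ε u : ℝ} (hε : 0 < ε)
    (hη : 0 ≤ eps1' k ε / (2 * width k ε))
    (hηa : 2 * (eps1' k ε / (2 * width k ε)) * (1 + 2 * ε) ≤ ε)
    (hu : 0 < u) {S : Matrix (Fin k) (Fin k) ℝ} (hS : Sᵀ = S) {i : Fin k}
    (hi : ∀ j, NormedSpace.exp (-(eps1' k ε) • S) j j ≤ NormedSpace.exp (-(eps1' k ε) • S) i i)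
    {f : Fin k → ℝ}
    (hf : f ⬝ᵥ (energyMatrix ε u (NormedSpace.exp (-(eps1' k ε) • S)) *ᵥ f) ≤ 1 + 2 * ε) :
    (NormedSpace.exp (-(eps1' k ε) • (S + lossMatrix ε u i f))).trace
      ≤ Real.exp (-(eps1' k ε) / 2) *
        (1 + 2 * (eps1' k ε / (2 * width k ε)) ^ 2 * (1 + 2 * ε) ^ 2) *
        (NormedSpace.exp (-(eps1' k ε) • S)).trace := by
  have hA : (-(eps1' k ε) • S)ᵀ = -(eps1' k ε) • S := by rw [transpose_smul, hS]
  have hW := posDef_exp hA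
  have hB : ∀ (c : ℝ) (g : Fin k → ℝ), (c • ((1 + 2 * ε) • single i i (1 : ℝ) - vecMulVec g g))ᵀ
      = c • ((1 + 2 * ε) • single i i (1 : ℝ) - vecMulVec g g) := by
    intro c g
    simp [transpose_vecMulVec]
  have key : -(eps1' k ε) • (S + lossMatrix ε u i f) = -(eps1' k ε) • S
      + -(eps1' k ε / (2 * width k ε)) • ((1 + 2 * ε) • single i i (1 : ℝ)
        - vecMulVec (u⁻¹ • f) (u⁻¹ • f))
      + (-(eps1' k ε) / 2) • (1 : Matrix (Fin k) (Fin k) ℝ) := by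
    rw [lossMatrix_eq hk hε, smul_add, smul_add, smul_smul, smul_smul, add_assoc]
    congr 3 <;> ring
  rw [key, exp_add_smul_one, trace_smul, smul_eq_mul, mul_assoc]
  refine mul_le_mul_of_nonneg_left ?_ (Real.exp_pos _).le
  exact (trace_exp_add_le hA (hB _ _)).trans
    (trace_mul_exp_rankOne_update_le hW.posSemidef i _ (by positivity) hε hη hηa hW.diag_pos
      (normalized_energy_le hu hW hi hf))

/-- On a sign vector `1ᵢ` contributes exactly `1`, whichever index `i` was selected. -/
theorem dotProduct_lossMatrix_mulVec (hk : 0 < k) {ε : ℝ} (hε : 0 < ε) (u : ℝ) (i : Fin k)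
    (f : Fin k → ℝ) {s : Fin k → ℝ} (hs : ∀ j, s j ^ 2 = 1) :
    2 * width k ε * (s ⬝ᵥ (lossMatrix ε u i f *ᵥ s))
      = (1 + 2 * ε) - (u⁻¹ * (s ⬝ᵥ f)) ^ 2 + width k ε * k := by
  have hw := width_pos hk hε
  have hss : s ⬝ᵥ s = k := by
    simp [dotProduct, ← pow_two, hs]
  have hsi : s ⬝ᵥ (single i i (1 : ℝ) *ᵥ s) = 1 := by
    rw [show s ⬝ᵥ (single i i (1 : ℝ) *ᵥ s) = s i ^ 2 by
      simp [dotProduct, Function.update_apply, pow_two, single_mulVec], hs]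
  rw [lossMatrix_eq hk hε]
  simp only [add_mulVec, sub_mulVec, smul_mulVec, vecMulVec_mulVec, one_mulVec, dotProduct_add,
    dotProduct_sub, dotProduct_smul, smul_eq_mul, hss, hsi, smul_dotProduct]
  simp
  rw [dotProduct_comm f s]
  field_simp

end Potential

variable {V E : Type*} [DecidableEq V] [Fintype E] {k : ℕ}

/-! ### Invariants of the outer loop. -/

section Invariants

variable {G : CapGraph V E} {d : Matrix V (Fin k) ℝ} {ε : ℝ}
  {oracle : ℕ → EdgeMatrices E k → Option (Flow E k)}
  {sel : Matrix (Fin k) (Fin k) ℝ → Fin k}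

/-- On each edge `S` is symmetric and `W = exp (-ε₁' S)`. -/
def OuterState.Consistent (ε : ℝ) (st : OuterState E k) : Prop :=
  ∀ e, (st.SW e).1ᵀ = (st.SW e).1 ∧ (st.SW e).2 = NormedSpace.exp (-(eps1' k ε) • (st.SW e).1)

omit [Fintype E] in
theorem OuterState.Consistent.posDef {st : OuterState E k} (h : st.Consistent ε) (e : E) :
    ((st.SW e).2).PosDef := by
  rw [(h e).2]
  exact posDef_exp (by rw [transpose_smul, (h e).1])

omit [DecidableEq V] [Fintype E] in
theorem outerRun_consistent {t : ℕ} {st : OuterState E k}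
    (h : outerRun G oracle sel ε t = some st) : st.Consistent ε := by
  induction t generalizing st with
  | zero =>
    simp only [outerRun, Option.some.injEq] at h
    subst h
    intro e
    simp
  | succ t ih =>
    simp only [outerRun, Option.bind_eq_some_iff, Option.map_eq_some_iff] at h
    obtain ⟨st', hst', f, -, rfl⟩ := h
    intro e
    refine ⟨?_, rfl⟩
    simp only [update, transpose_add, transpose_lossMatrix, (ih hst' e).1]

/-- `W` stays positive definite, so every query is well conditioned and the oracle's guarantee is
available at each step. -/
theorem outerRun_induction (hk : 0 < k) (hε : 0 < ε) (hε1 : ε ≤ 1)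
    (horacle : IsQuadCapFlowOracle G d (2 * k / ε) (1 + ε) (1 + 2 * ε) oracle)
    {p : ℕ → OuterState E k → Prop} (h0 : p 0 ⟨fun _ => (0, 1), 0⟩)
    (hstep : ∀ t st f, p t st → st.Consistent ε → G.MeetsDemands d f →
      (∀ e, f e ⬝ᵥ (energyMatrix ε (G.cap e) (st.SW e).2 *ᵥ f e) ≤ 1 + 2 * ε) →
      p (t + 1) ⟨fun e => update sel ε (G.cap e) (st.SW e) (f e), st.total + f⟩)
    {t : ℕ} {st : OuterState E k} (h : outerRun G oracle sel ε t = some st) : p t st := by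
  induction t generalizing st with
  | zero =>
    simp only [outerRun, Option.some.injEq] at h
    exact h ▸ h0
  | succ t ih =>
    simp only [outerRun, Option.bind_eq_some_iff, Option.map_eq_some_iff] at h
    obtain ⟨st', hst', f, hf, rfl⟩ := h
    have hc := outerRun_consistent hst'
    have ho := (horacle t _ (wellConditioned_energyMatrix hk hε hε1 G.cap_pos hc.posDef)).1 f hf
    exact hstep t st' f (ih hst') hc ho.1 ho.2

theorem exists_outerRun_eq_some (hk : 0 < k) (hε : 0 < ε) (hε1 : ε ≤ 1)
    (horacle : IsQuadCapFlowOracle G d (2 * k / ε) (1 + ε) (1 + 2 * ε) oracle)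
    (hf : ∃ f, G.MeetsDemands d f ∧ ∀ e, l1OnEdge f e ≤ G.cap e) (t : ℕ) :
    ∃ st, outerRun G oracle sel ε t = some st := by
  induction t with
  | zero => exact ⟨_, rfl⟩
  | succ t ih =>
    obtain ⟨st, hst⟩ := ih
    have hc := outerRun_consistent hst
    obtain ⟨f, hfd, hfu⟩ := hf
    have ho := (horacle t _ (wellConditioned_energyMatrix hk hε hε1 G.cap_pos hc.posDef)).2
    cases hq : oracle t fun e => energyMatrix ε (G.cap e) (st.SW e).2 with
    | none =>
      exact absurd ⟨f, hfd, fun e => energy_le_of_l1_le hε.le (G.cap_pos e)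
        (maxEntry_pos (hc.posDef e) ⟨0, hk⟩) (hfu e)⟩ (ho hq)
    | some g => exact ⟨_, by simp only [outerRun, hst, Option.bind_some, hq, Option.map_some]; rfl⟩

theorem outerRun_meetsDemands (hk : 0 < k) (hε : 0 < ε) (hε1 : ε ≤ 1)
    (horacle : IsQuadCapFlowOracle G d (2 * k / ε) (1 + ε) (1 + 2 * ε) oracle)
    {t : ℕ} {st : OuterState E k} (h : outerRun G oracle sel ε t = some st) :
    G.MeetsDemands ((t : ℝ) • d) st.total := by
  refine outerRun_induction hk hε hε1 horacle
    (p := fun t st => G.MeetsDemands ((t : ℝ) • d) st.total) ?_ ?_ h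
  · simp [CapGraph.MeetsDemands]
  · intro t st f hp _ hf _
    simp only [CapGraph.MeetsDemands] at hp hf ⊢
    rw [Matrix.mul_add, hp, hf]
    push_cast
    rw [add_smul, one_smul]

/-- The sum of the squared congestions dominates the square of the summed congestion. -/
theorem outerRun_congestion_le (hk : 0 < k) (hε : 0 < ε) (hε1 : ε ≤ 1)
    (horacle : IsQuadCapFlowOracle G d (2 * k / ε) (1 + ε) (1 + 2 * ε) oracle)
    {t : ℕ} {st : OuterState E k} (h : outerRun G oracle sel ε t = some st) (e : E)
    {s : Fin k → ℝ} (hs : ∀ j, s j ^ 2 = 1) (c : ℝ) :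
    2 * c * ((G.cap e)⁻¹ * (s ⬝ᵥ st.total e)) - t * c ^ 2
      ≤ (1 + 2 * ε) * t + width k ε * k * t
        - 2 * width k ε * (s ⬝ᵥ ((st.SW e).1 *ᵥ s)) := by
  refine outerRun_induction hk hε hε1 horacle (p := fun t st =>
    2 * c * ((G.cap e)⁻¹ * (s ⬝ᵥ st.total e)) - t * c ^ 2
      ≤ (1 + 2 * ε) * t + width k ε * k * t
        - 2 * width k ε * (s ⬝ᵥ ((st.SW e).1 *ᵥ s))) ?_ ?_ h
  · simp [show (0 : Flow E k) e = 0 from rfl]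
  · intro t st f hp _ _ _
    have h1 := dotProduct_lossMatrix_mulVec hk hε (G.cap e) (sel (st.SW e).2) (f e) hs
    simp only [update, add_mulVec, dotProduct_add, mul_add,
      show (st.total + f) e = st.total e + f e from rfl]
    rw [h1]
    push_cast
    -- The tangent bound `2cx - c² ≤ x²` makes the left side linear in the flow, so the accumulated
    -- total suffices.
    linarith [sq_nonneg ((G.cap e)⁻¹ * (s ⬝ᵥ f e) - c)]

theorem outerRun_trace_le (hk : 2 ≤ k) (hε : 0 < ε) (hε1 : ε ≤ 1)
    (horacle : IsQuadCapFlowOracle G d (2 * k / ε) (1 + ε) (1 + 2 * ε) oracle)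
    (hsel : IsDiagArgmax sel)
    {t : ℕ} {st : OuterState E k} (h : outerRun G oracle sel ε t = some st) (e : E) :
    (st.SW e).2.trace ≤ (Real.exp (-(eps1' k ε) / 2) *
        (1 + 2 * (eps1' k ε / (2 * width k ε)) ^ 2 * (1 + 2 * ε) ^ 2)) ^ t * k := by
  have hk0 : 0 < k := by omega
  have hk' : (2 : ℝ) ≤ k := by exact_mod_cast hk
  obtain ⟨h1, h2⟩ := rate_bounds hk hε hε1
  have hη : 0 ≤ eps1' k ε / (2 * width k ε) := le_trans (by positivity) h1
  -- As `k ≥ 2`, `η ≤ ε/6`, while `1 + 2ε ≤ 3`.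
  have hηa : 2 * (eps1' k ε / (2 * width k ε)) * (1 + 2 * ε) ≤ ε := by
    have : ε / (k : ℝ) ^ 2 ≤ ε / 2 ^ 2 := by gcongr
    nlinarith
  refine outerRun_induction hk0 hε hε1 horacle (p := fun t st => (st.SW e).2.trace ≤
    (Real.exp (-(eps1' k ε) / 2) *
      (1 + 2 * (eps1' k ε / (2 * width k ε)) ^ 2 * (1 + 2 * ε) ^ 2)) ^ t * k) ?_ ?_ h
  · simp
  · intro t st f hp hc _ hf
    have hfe := hf e
    have hi := hsel (st.SW e).2
    rw [(hc e).2] at hp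
    have hst := trace_exp_update_le hk0 hε hη hηa (G.cap_pos e) (hc e).1
      (i := sel (st.SW e).2) (by rw [← (hc e).2]; exact hi) (by rw [← (hc e).2]; exact hfe)
    refine hst.trans ?_
    rw [pow_succ' _ t, mul_assoc _ _ (k : ℝ)]
    gcongr

theorem outerRun_l1_sq_le (hk : 2 ≤ k) (hε : 0 < ε) (hε1 : ε ≤ 1)
    (horacle : IsQuadCapFlowOracle G d (2 * k / ε) (1 + ε) (1 + 2 * ε) oracle)
    (hsel : IsDiagArgmax sel) {N : ℕ}
    (hN : (k : ℝ) ^ (7 / 2 : ℝ) * ε ^ (-(5 / 2) : ℝ) * Real.log k ≤ N)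
    {st : OuterState E k} (h : outerRun G oracle sel ε N = some st) (e : E) (c : ℝ) :
    2 * c * ((G.cap e)⁻¹ * l1OnEdge st.total e) - N * c ^ 2 ≤ N * (1 + 3 * ε) ^ 2 := by
  have hk0 : 0 < k := by omega
  have hk' : (0 : ℝ) < k := by exact_mod_cast hk0
  have hw := width_pos hk0 hε
  obtain ⟨h1, h2⟩ := rate_bounds hk hε hε1
  set δ := eps1' k ε with hδ
  set η := δ / (2 * width k ε) with hη
  have hη0 : 0 < η := lt_of_lt_of_le (by positivity) h1
  have hδη : δ = η * (2 * width k ε) := by rw [hη]; field_simp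
  -- The signs are chosen in hindsight; this is legitimate because the spectral bound on `S` holds
  -- for all vectors.
  let s : Fin k → ℝ := fun j => if 0 ≤ st.total e j then 1 else -1
  have hs : ∀ j, s j ^ 2 = 1 := fun j => by simp only [s]; split_ifs <;> norm_num
  have hss : s ⬝ᵥ s = k := by simp [dotProduct, ← pow_two, hs]
  have hsf : s ⬝ᵥ st.total e = l1OnEdge st.total e := by
    refine Finset.sum_congr rfl fun j _ => ?_
    simp only [s]
    split_ifs with hj
    · rw [abs_of_nonneg hj, one_mul]
    · rw [abs_of_neg (not_le.1 hj), neg_one_mul]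
  have hc := outerRun_congestion_le hk0 hε hε1 horacle h e hs c
  rw [hsf] at hc
  have hcons := outerRun_consistent h
  have htr := outerRun_trace_le hk hε hε1 horacle hsel h e
  rw [← hδ, ← hη] at htr
  have hA : (-δ • (st.SW e).1)ᵀ = -δ • (st.SW e).1 := by rw [transpose_smul, (hcons e).1]
  have hquad := dotProduct_mulVec_le_log_trace_exp hA s
  have : Nonempty (Fin k) := ⟨⟨0, hk0⟩⟩
  have hlog : Real.log (NormedSpace.exp (-δ • (st.SW e).1)).trace
      ≤ N * (-δ / 2 + 2 * η ^ 2 * (1 + 2 * ε) ^ 2) + Real.log k := by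
    rw [hδ, ← (hcons e).2]
    refine (Real.log_le_log (hcons.posDef e).trace_pos htr).trans ?_
    rw [Real.log_mul (by positivity) hk'.ne', Real.log_pow,
      Real.log_mul (Real.exp_pos _).ne' (by positivity), Real.log_exp]
    gcongr
    refine (Real.log_le_sub_one_of_pos (by positivity)).trans (le_of_eq (by ring))
  rw [hss, smul_mulVec, dotProduct_smul, smul_eq_mul] at hquad
  have hq := hquad.trans (mul_le_mul_of_nonneg_right hlog hk'.le)
  have hfin := averaged_energy_bound hk hε hε1 h1 h2 hN
  refine hc.trans (le_trans ?_ hfin)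
  have e1 : η * (k * Real.log k / η) = k * Real.log k := by field_simp
  refine le_of_mul_le_mul_left ?_ hη0
  simp only [mul_add, mul_sub, e1]
  rw [hδη] at hq
  linarith

/-- For `k = 1` the rate estimates can fail (`ε₁ = 1` when `ε = 1`), but `W` cancels from the
energy: each single flow already obeys the bound, and the triangle inequality sums them. -/
theorem outerRun_l1_le_of_one (hε : 0 < ε) (hε1 : ε ≤ 1) {d : Matrix V (Fin 1) ℝ}
    {oracle : ℕ → EdgeMatrices E 1 → Option (Flow E 1)} {sel : Matrix (Fin 1) (Fin 1) ℝ → Fin 1}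
    (horacle : IsQuadCapFlowOracle G d (2 * (1 : ℕ) / ε) (1 + ε) (1 + 2 * ε) oracle)
    {t : ℕ} {st : OuterState E 1} (h : outerRun G oracle sel ε t = some st) (e : E) :
    l1OnEdge st.total e ≤ t * ((1 + 3 * ε) * G.cap e) := by
  refine outerRun_induction one_pos hε hε1 horacle
    (p := fun t st => l1OnEdge st.total e ≤ t * ((1 + 3 * ε) * G.cap e)) ?_ ?_ h
  · simp [l1OnEdge]
  · intro t st f hp hc _ hf
    have hu := G.cap_pos e
    have h1 := normalized_energy_le (i := 0) hu (hc.posDef e)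
      (fun j => by rw [Subsingleton.elim j 0]) (hf e)
    have hpos : 0 < (st.SW e).2 0 0 := (hc.posDef e).diag_pos
    simp only [dotProduct, mulVec, Finset.univ_unique, Fin.default_eq_zero, Finset.sum_singleton,
      Pi.smul_apply, smul_eq_mul] at h1
    set x := (G.cap e)⁻¹ * f e 0 with hx
    have h2 : (1 + ε) * x ^ 2 ≤ 1 + 2 * ε := by
      refine le_of_mul_le_mul_right ?_ hpos
      linarith
    have h3 : |x| ≤ 1 + 3 * ε := abs_le_of_sq_le_sq (by nlinarith [sq_nonneg x]) (by positivity)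
    have h4 : |f e 0| ≤ (1 + 3 * ε) * G.cap e := by
      rw [hx, abs_mul, abs_of_pos (inv_pos.2 hu), inv_mul_le_iff₀ hu] at h3
      linarith
    simp only [l1OnEdge, Finset.univ_unique, Fin.default_eq_zero, Finset.sum_singleton,
      Matrix.add_apply] at hp ⊢
    push_cast
    linarith [abs_add_le (st.total e 0) (f e 0)]

end Invariants

end MultiFlow

theorem mainTheorem5 {V E : Type*} [DecidableEq V] [Fintype E]
    (G : MultiFlow.CapGraph V E) (k : ℕ) (d : Matrix V (Fin k) ℝ)
    (ε : ℝ) (hε0 : 0 < ε) (hε1 : ε ≤ 1)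
    (oracle : ℕ → MultiFlow.EdgeMatrices E k → Option (MultiFlow.Flow E k))
    (horacle : MultiFlow.IsQuadCapFlowOracle G d (2 * k / ε) (1 + ε) (1 + 2 * ε) oracle)
    (sel : Matrix (Fin k) (Fin k) ℝ → Fin k) (hsel : MultiFlow.IsDiagArgmax sel)
    (N : ℕ) (hN0 : 1 ≤ N)
    (hN : (k : ℝ) ^ (7 / 2 : ℝ) * ε ^ (-(5 / 2) : ℝ) * Real.log k ≤ N) :
    (∀ f, MultiFlow.maxConcurrentFlow G oracle sel ε N = some f →
      G.MeetsDemands d f ∧ ∀ e, MultiFlow.l1OnEdge f e ≤ (1 + 3 * ε) * G.cap e) ∧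
    ((∃ f, G.MeetsDemands d f ∧ ∀ e, MultiFlow.l1OnEdge f e ≤ G.cap e) →
      ∃ f, MultiFlow.maxConcurrentFlow G oracle sel ε N = some f) := by
  have hk : 0 < k := (sel 0).pos
  have hN' : (0 : ℝ) < N := by exact_mod_cast hN0
  refine ⟨fun f hf => ?_, fun hf => ?_⟩
  · obtain ⟨st, hst, rfl⟩ := Option.map_eq_some_iff.1 hf
    constructor
    · have h := MultiFlow.outerRun_meetsDemands hk hε0 hε1 horacle hst
      rw [MultiFlow.CapGraph.MeetsDemands] at h ⊢
      rw [Matrix.mul_smul, h, smul_smul, one_div, inv_mul_cancel₀ hN'.ne', one_smul]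
    · intro e
      have hl : MultiFlow.l1OnEdge ((1 / (N : ℝ)) • st.total) e
          = (N : ℝ)⁻¹ * MultiFlow.l1OnEdge st.total e := by
        simp [MultiFlow.l1OnEdge, abs_mul, Finset.mul_sum]
      rw [hl, inv_mul_le_iff₀ hN']
      rcases (show k = 1 ∨ 2 ≤ k by omega) with rfl | hk2
      · exact MultiFlow.outerRun_l1_le_of_one hε0 hε1 horacle hst e
      · have hu := G.cap_pos e
        -- The choice `c = 1 + 3ε` makes the tangent bound sharp: `2cx ≤ 2Nc²`.
        have h := MultiFlow.outerRun_l1_sq_le hk2 hε0 hε1 horacle hsel hN hst e (1 + 3 * ε)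
        have h2 : (G.cap e)⁻¹ * MultiFlow.l1OnEdge st.total e ≤ N * (1 + 3 * ε) := by
          refine le_of_mul_le_mul_left ?_ (show 0 < 2 * (1 + 3 * ε) by positivity)
          linarith
        rw [inv_mul_le_iff₀ hu] at h2
        linarith
  · obtain ⟨st, hst⟩ := MultiFlow.exists_outerRun_eq_some (sel := sel) hk hε0 hε1 horacle hf N
    exact ⟨_, by rw [MultiFlow.maxConcurrentFlow, hst, Option.map_some]⟩
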